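/- Let $\mathcal H$ be a complex Hilbert space (inner product linear in the second argument), let $K$ be a bounded and boundedly invertible operator on $\mathcal H$, and let $S$ be a densely defined, closed, symmetric operator in $\mathcal H$ which is strictly positive, i.e. $\langle f,Sf\rangle\ge\varepsilon\|f\|^2$ for all $f\in\mathcal D(S)$ and some $\varepsilon>0$. An operator $T$ is called $K$-invariant if $K^*TK=T$ (including equality of domains, $\mathcal D(K^*TK)=\{f : Kf\in\mathcal D(T)\}$); assume that $S$ is $K$-invariant. A densely defined operator $A$ is called dissipative if $\operatorname{Im}\langle f,Af\rangle\ge 0$ for all $f\in\mathcal D(A)$, and maximally dissipative if moreover it has no proper dissipative extension. Let $S_F=S^*\upharpoonright_{\mathcal D(S_F)}$ and $S_K=S^*\upharpoonright_{\mathcal D(S_K)}$ be the Friedrichs and Krein--von Neumann extensions of $S$, where $\mathcal D(S_F)$ (resp. $\mathcal D(S_K)$) consists of those $f\in\mathcal D(S^*)$ for which there is a sequence $(f_n)\subset\mathcal D(S)$ with $\langle f_n-f_m,S(f_n-f_m)\rangle\to0$ as $n,m\to\infty$ and $\|f_n-f\|\to0$ (resp. $\|S^*(f_n-f)\|\to0$).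 Assume that $\ker(S^*)$ is one-dimensional and spanned by the unit vector $\eta$. Then $S_F$ is the largest and $S_K$ the smallest nonnegative self-adjoint extension of $S$ (with respect to the order $A_1\le A_2$ iff $\mathcal D(A_2^{1/2})\subseteq\mathcal D(A_1^{1/2})$ and $\|A_1^{1/2}f\|\le\|A_2^{1/2}f\|$ for $f\in\mathcal D(A_2^{1/2})$), there is $\zeta\in\mathbb C$ with $K\eta=\zeta\eta$, and the following hold. (i) If $|\zeta|\ne1$, then $S_F\ne S_K$, and $S_F$ and $S_K$ are precisely the $K$-invariant maximally dissipative extensions of $S$. (ii) If $|\zeta|=1$, then every maximally dissipative extension of $S$ is $K$-invariant. -/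

import Mathlib

open Filter Topology
open scoped LinearPMap

namespace KInv

noncomputable section

variable {H : Type*} [NormedAddCommGroup H] [InnerProductSpace ℂ H]

/-- The quadratic form `f ↦ ⟨f, T f⟩` of an operator; only its real part is recorded, which is
the whole value when `T` is symmetric. -/
def quad (T : H →ₗ.[ℂ] H) (f : T.domain) : ℝ := (inner ℂ (f : H) (T f)).re

/-- A densely defined symmetric operator. -/
structure IsSymm (S : H →ₗ.[ℂ] H) : Prop where
  dense : Dense (S.domain : Set H)
  symm : ∀ f g : S.domain, inner ℂ (S f) (g : H) = inner ℂ (f : H) (S g)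

/-- A nonnegative (densely defined) symmetric operator. -/
structure IsNonneg (S : H →ₗ.[ℂ] H) : Prop extends IsSymm S where
  nonneg : ∀ f : S.domain, 0 ≤ quad S f

/-- A strictly positive (densely defined) symmetric operator: `S ≥ ε I` for some `ε > 0`. -/
structure IsStrictlyPos (S : H →ₗ.[ℂ] H) : Prop extends IsSymm S where
  pos : ∃ ε : ℝ, 0 < ε ∧ ∀ f : S.domain, ε * ‖(f : H)‖ ^ 2 ≤ quad S f

theorem IsStrictlyPos.isNonneg {S : H →ₗ.[ℂ] H} (hS : IsStrictlyPos S) : IsNonneg S where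
  toIsSymm := hS.toIsSymm
  nonneg f := by
    obtain ⟨ε, hε, h⟩ := hS.pos
    exact le_trans (by positivity) (h f)

/-- A sequence in the domain of `T` which is Cauchy for the form of `T`:
`⟨u_n - u_m, T (u_n - u_m)⟩ → 0` as `n, m → ∞`. -/
def FormCauchy (T : H →ₗ.[ℂ] H) (u : ℕ → T.domain) : Prop :=
  Tendsto (fun p : ℕ × ℕ => quad T (u p.1 - u p.2)) atTop (𝓝 0)

theorem quad_add_le {S : H →ₗ.[ℂ] H} (hS : IsNonneg S) (f g : S.domain) :
    quad S (f + g) ≤ 2 * quad S f + 2 * quad S g := by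
  have h := hS.nonneg (f - g)
  simp only [quad, LinearPMap.map_add, LinearPMap.map_sub, Submodule.coe_add,
    AddSubgroupClass.coe_sub, inner_add_left, inner_add_right, inner_sub_left, inner_sub_right,
    Complex.add_re, Complex.sub_re] at h ⊢
  linarith

theorem quad_smul (S : H →ₗ.[ℂ] H) (c : ℂ) (f : S.domain) :
    quad S (c • f) = ‖c‖ ^ 2 * quad S f := by
  have : (starRingEnd ℂ) c * c = ((‖c‖ ^ 2 : ℝ) : ℂ) := by
    rw [mul_comm, Complex.mul_conj, Complex.normSq_eq_norm_sq]
  simp only [quad, LinearPMap.map_smul, Submodule.coe_smul, inner_smul_left, inner_smul_right]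
  rw [← mul_assoc, mul_comm c, this, Complex.re_ofReal_mul]

theorem formCauchy_zero (S : H →ₗ.[ℂ] H) : FormCauchy S (fun _ => 0) := by
  simp [FormCauchy, quad]

theorem FormCauchy.add {S : H →ₗ.[ℂ] H} (hS : IsNonneg S) {u v : ℕ → S.domain}
    (hu : FormCauchy S u) (hv : FormCauchy S v) : FormCauchy S (fun n => u n + v n) := by
  unfold FormCauchy at *
  have hb := (hu.const_mul 2).add (hv.const_mul 2)
  simp only [mul_zero, add_zero] at hb
  refine squeeze_zero (fun p => hS.nonneg _) (fun p => ?_) hb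
  rw [add_sub_add_comm]
  exact quad_add_le hS _ _

theorem FormCauchy.smul {S : H →ₗ.[ℂ] H} (c : ℂ) {u : ℕ → S.domain}
    (hu : FormCauchy S u) : FormCauchy S (fun n => c • u n) := by
  unfold FormCauchy at *
  have hb := hu.const_mul (‖c‖ ^ 2)
  rw [mul_zero] at hb
  refine hb.congr fun p => ?_
  rw [← smul_sub, quad_smul]

/-- A densely defined operator `A` is dissipative if `Im ⟨f, A f⟩ ≥ 0` on its domain. -/
def IsDissipative (A : H →ₗ.[ℂ] H) : Prop :=
  Dense (A.domain : Set H) ∧ ∀ f : A.domain, 0 ≤ (inner ℂ (f : H) (A f)).im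

/-- A dissipative operator without nontrivial dissipative extensions. -/
def IsMaxDissipative (A : H →ₗ.[ℂ] H) : Prop :=
  IsDissipative A ∧ ∀ B : H →ₗ.[ℂ] H, IsDissipative B → A ≤ B → B = A

/-- The kernel of an operator, as a subspace of the whole space. -/
def kernel (T : H →ₗ.[ℂ] H) : Submodule ℂ H := (LinearMap.ker T.toFun).map T.domain.subtype

variable [CompleteSpace H]

/-- The Friedrichs extension `S_F` of a nonnegative symmetric operator: the restriction of `S†`
to those `f` in its domain for which there are `u_n` in the domain of `S` with `u_n → f` and
`⟨u_n - u_m, S (u_n - u_m)⟩ → 0`. -/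
def friedrichs (S : H →ₗ.[ℂ] H) (hS : IsNonneg S) : H →ₗ.[ℂ] H where
  domain :=
    { carrier := {f | f ∈ S†.domain ∧ ∃ u : ℕ → S.domain,
        Tendsto (fun n => (u n : H)) atTop (𝓝 f) ∧ FormCauchy S u}
      zero_mem' := ⟨zero_mem _, fun _ => 0, by simp, formCauchy_zero S⟩
      add_mem' := by
        rintro f g ⟨hf, u, hu, hu'⟩ ⟨hg, v, hv, hv'⟩
        exact ⟨add_mem hf hg, fun n => u n + v n, by simpa using hu.add hv, hu'.add hS hv'⟩
      smul_mem' := by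
        rintro c f ⟨hf, u, hu, hu'⟩
        exact ⟨Submodule.smul_mem _ c hf, fun n => c • u n, by simpa using hu.const_smul c,
          hu'.smul c⟩ }
  toFun := S†.toFun ∘ₗ Submodule.inclusion (fun _ h => h.1)

/-- The Krein--von Neumann extension `S_K` of a nonnegative symmetric operator: the restriction
of `S†` to those `f` in its domain for which there are `u_n` in the domain of `S` with
`S† u_n = S u_n → S† f` and `⟨u_n - u_m, S (u_n - u_m)⟩ → 0`. -/
def krein (S : H →ₗ.[ℂ] H) (hS : IsNonneg S) : H →ₗ.[ℂ] H where
  domain :=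
    { carrier := {f | ∃ hf : f ∈ S†.domain, ∃ u : ℕ → S.domain,
        Tendsto (fun n => S (u n)) atTop (𝓝 (S† ⟨f, hf⟩)) ∧ FormCauchy S u}
      zero_mem' := by
        refine ⟨zero_mem _, fun _ => 0, ?_, formCauchy_zero S⟩
        have h : S† ⟨0, zero_mem _⟩ = 0 := S†.map_zero
        simp [h]
      add_mem' := by
        rintro f g ⟨hf, u, hu, hu'⟩ ⟨hg, v, hv, hv'⟩
        refine ⟨add_mem hf hg, fun n => u n + v n, ?_, hu'.add hS hv'⟩
        have h : S† ⟨f + g, add_mem hf hg⟩ = S† ⟨f, hf⟩ + S† ⟨g, hg⟩ :=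
          S†.map_add ⟨f, hf⟩ ⟨g, hg⟩
        rw [h]
        simpa only [LinearPMap.map_add] using hu.add hv
      smul_mem' := by
        rintro c f ⟨hf, u, hu, hu'⟩
        refine ⟨Submodule.smul_mem _ c hf, fun n => c • u n, ?_, hu'.smul c⟩
        have h : S† ⟨c • f, Submodule.smul_mem _ c hf⟩ = c • S† ⟨f, hf⟩ :=
          S†.map_smul c ⟨f, hf⟩
        rw [h]
        simpa only [LinearPMap.map_smul] using hu.const_smul c }
  toFun := S†.toFun ∘ₗ Submodule.inclusion (fun _ h => h.1)

/-- For a nonnegative self-adjoint operator `A`: `f` lies in the domain of `A^{1/2}`, that is, in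
the domain of the closed form of `A`, and `‖A^{1/2} f‖ ^ 2 = c`. -/
def HasFormValue (A : H →ₗ.[ℂ] H) (f : H) (c : ℝ) : Prop :=
  ∃ u : ℕ → A.domain, Tendsto (fun n => (u n : H)) atTop (𝓝 f) ∧ FormCauchy A u ∧
    Tendsto (fun n => quad A (u n)) atTop (𝓝 c)

/-- The order `A ≤ B` of nonnegative self-adjoint operators: the domain of `B^{1/2}` is contained
in that of `A^{1/2}`, and `‖A^{1/2} f‖ ≤ ‖B^{1/2} f‖` for every `f` in the former. -/
def FormLE (A B : H →ₗ.[ℂ] H) : Prop :=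
  ∀ (f : H) (c : ℝ), HasFormValue B f c → ∃ c' ≤ c, HasFormValue A f c'

/-- `A` is a nonnegative self-adjoint extension of `S`. -/
def IsNonnegSelfAdjointExt (S A : H →ₗ.[ℂ] H) : Prop :=
  S ≤ A ∧ IsSelfAdjoint A ∧ ∀ f : A.domain, 0 ≤ quad A f

/-- `A` is the largest nonnegative self-adjoint extension of `S`. -/
def IsLargestExt (S A : H →ₗ.[ℂ] H) : Prop :=
  IsNonnegSelfAdjointExt S A ∧ ∀ B, IsNonnegSelfAdjointExt S B → FormLE B A

/-- `A` is the smallest nonnegative self-adjoint extension of `S`. -/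
def IsSmallestExt (S A : H →ₗ.[ℂ] H) : Prop :=
  IsNonnegSelfAdjointExt S A ∧ ∀ B, IsNonnegSelfAdjointExt S B → FormLE A B

/-- The operator `K* T K` with its natural domain `{f | K f ∈ D(T)}`. -/
def conj (K : H →L[ℂ] H) (T : H →ₗ.[ℂ] H) : H →ₗ.[ℂ] H where
  domain := T.domain.comap (K : H →ₗ[ℂ] H)
  toFun := ((ContinuousLinearMap.adjoint K : H →L[ℂ] H) : H →ₗ[ℂ] H) ∘ₗ T.toFun ∘ₗ
    (K : H →ₗ[ℂ] H).restrict (fun _ h => h)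

/-- `T` is `K`-invariant: `K* T K = T`, including equality of the domains. -/
def IsKInvariant (K : H →L[ℂ] H) (T : H →ₗ.[ℂ] H) : Prop := conj K T = T

end

end KInv

/-!
Complete `S.domain` to a Hilbert space for the energy inner product `⟨f, S g⟩`. By strict
positivity the inclusion of `S.domain` in `H` extends to a bounded operator `J` on this completion,
with `J* S f = f`. Then `G = J J*` is the inverse of the Friedrichs extension, `f - G S† f` lies in
`ker S†` for every `f` in the domain of `S†`, and `f` belongs to the Krein extension iff `S† f` is
orthogonal to `ker S†`.

When `ker S†` is spanned by the unit vector `η`, write `f - G S† f = b η` and `a = ⟨η, S† f⟩`.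
Green's identity becomes `Im ⟨f, S† f⟩ = Im (b̄ a)`, the Friedrichs extension is `b = 0` and the
Krein extension is `a = 0`. As `K` preserves the Friedrichs domain and `K η = ζ η`, it acts on the
boundary values `(a, b)` as `diag (1 / ζ̄, ζ)`. If `|ζ| ≠ 1`, the eigenvalues are distinct, so the
invariant subspaces are spanned by coordinate axes, and the whole plane is not dissipative. If
`|ζ| = 1`, the action is scalar, and every subspace is invariant.
-/

namespace KInv

noncomputable section

open UniformSpace

section Extension

variable {H : Type*} [NormedAddCommGroup H] [InnerProductSpace ℂ H] {S T R : H →ₗ.[ℂ] H}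

theorem apply_inclusion (h : S ≤ T) (f : S.domain) : T (Submodule.inclusion h.1 f) = S f :=
  (h.2 rfl).symm

theorem le_of_le_of_domain_le (hS : S ≤ R) (hT : T ≤ R) (h : S.domain ≤ T.domain) : S ≤ T :=
  ⟨h, fun f g hfg => (apply_inclusion hS f).symm.trans
    ((congrArg R (Subtype.ext hfg)).trans (apply_inclusion hT g))⟩

theorem eq_of_le_of_domain_eq (hS : S ≤ R) (hT : T ≤ R) (h : S.domain = T.domain) : S = T :=
  LinearPMap.eq_of_le_of_domain_eq (le_of_le_of_domain_le hS hT h.le) h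

theorem quad_inclusion (h : S ≤ T) (f : S.domain) :
    quad T (Submodule.inclusion h.1 f) = quad S f := by
  rw [quad, apply_inclusion h, Submodule.coe_inclusion, quad]

theorem HasFormValue.mono (h : S ≤ T) {f : H} {c : ℝ} (hf : HasFormValue S f c) :
    HasFormValue T f c := by
  obtain ⟨u, hu, hcauchy, hlim⟩ := hf
  refine ⟨fun n => Submodule.inclusion h.1 (u n), hu, ?_, ?_⟩
  · simpa only [FormCauchy, ← map_sub, quad_inclusion h] using hcauchy
  · simpa only [quad_inclusion h] using hlim

theorem formCauchy_const (T : H →ₗ.[ℂ] H) (f : T.domain) : FormCauchy T fun _ => f := by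
  simp [FormCauchy, quad]

theorem mem_kernel {f : H} : f ∈ kernel T ↔ ∃ hf : f ∈ T.domain, T ⟨f, hf⟩ = 0 :=
  ⟨fun ⟨y, hy, hyf⟩ => hyf ▸ ⟨y.2, hy⟩, fun ⟨hf, h⟩ => ⟨⟨f, hf⟩, h, rfl⟩⟩

end Extension

section Adjoint

variable {H : Type*} [NormedAddCommGroup H] [InnerProductSpace ℂ H] [CompleteSpace H]
  {A S T : H →ₗ.[ℂ] H}

theorem exists_adjoint_apply_eq (hT : Dense (T.domain : Set H)) {f g : H}
    (h : ∀ x : T.domain, inner ℂ g (x : H) = inner ℂ f (T x)) :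
    ∃ hf : f ∈ T†.domain, T† ⟨f, hf⟩ = g :=
  ⟨LinearPMap.mem_adjoint_domain_of_exists f ⟨g, h⟩, LinearPMap.adjoint_apply_eq hT _ h⟩

theorem adjoint_le_adjoint (hS : Dense (S.domain : Set H)) (h : S ≤ T) : T† ≤ S† :=
  LinearPMap.IsFormalAdjoint.le_adjoint hS <| LinearPMap.IsFormalAdjoint.symm fun f x => by
    rw [← apply_inclusion h x]
    exact LinearPMap.adjoint_isFormalAdjoint (hS.mono h.1) f (Submodule.inclusion h.1 x)

theorem mem_kernel_adjoint (hT : Dense (T.domain : Set H)) {f : H} :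
    f ∈ kernel T† ↔ ∀ x : T.domain, inner ℂ f (T x) = 0 := by
  rw [mem_kernel]
  constructor
  · rintro ⟨hf, h⟩ x
    rw [← LinearPMap.adjoint_isFormalAdjoint hT ⟨f, hf⟩ x, h, inner_zero_left]
  · intro h
    exact exists_adjoint_apply_eq hT fun x => by rw [h, inner_zero_left]

theorem kernel_adjoint_eq_orthogonal (hT : Dense (T.domain : Set H)) :
    kernel T† = (LinearMap.range T.toFun)ᗮ := by
  ext f
  rw [mem_kernel_adjoint hT, Submodule.mem_orthogonal']
  exact (Set.forall_mem_range (f := T) (p := fun y => inner ℂ f y = 0)).symm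

theorem IsSymm.le_adjoint (hT : IsSymm T) : T ≤ T† :=
  LinearPMap.IsFormalAdjoint.le_adjoint hT.dense hT.symm

theorem isSymm_of_isSelfAdjoint (hA : IsSelfAdjoint A) : IsSymm A where
  dense := hA.dense_domain
  symm := by
    have h := LinearPMap.adjoint_isFormalAdjoint hA.dense_domain
    rwa [LinearPMap.isSelfAdjoint_def.1 hA] at h

theorem IsSymm.isSelfAdjoint (hA : IsSymm A) (h : A†.domain ≤ A.domain) : IsSelfAdjoint A :=
  (LinearPMap.eq_of_le_of_domain_eq hA.le_adjoint (le_antisymm hA.le_adjoint.1 h)).symm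

theorem IsSymm.isSelfAdjoint_of_surjective (hA : IsSymm A) (h : Function.Surjective A) :
    IsSelfAdjoint A := by
  refine hA.isSelfAdjoint fun f hf => ?_
  obtain ⟨g, hg⟩ := h (A† ⟨f, hf⟩)
  have horth : ∀ y, inner ℂ (f - g) y = 0 := fun y => by
    obtain ⟨x, rfl⟩ := h y
    rw [inner_sub_left, ← hA.symm, hg, ← LinearPMap.adjoint_isFormalAdjoint hA.dense ⟨f, hf⟩ x,
      sub_self]
  rw [sub_eq_zero.1 (inner_self_eq_zero.1 (horth _))]
  exact g.2

end Adjoint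

section Dissipative

variable {H : Type*} [NormedAddCommGroup H] [InnerProductSpace ℂ H] {A R S T : H →ₗ.[ℂ] H}

theorem eq_zero_of_forall_im_mul_add_nonneg {z : ℂ} {r : ℝ} (h : ∀ c : ℂ, 0 ≤ (c * z).im + r) :
    z = 0 := by
  by_contra hz
  have := h (((-(r + 1) : ℝ) * Complex.I) / z)
  rw [div_mul_cancel₀ _ hz, Complex.im_ofReal_mul, Complex.I_im] at this
  linarith

theorem IsSymm.im_inner_self (hT : IsSymm T) (f : T.domain) : (inner ℂ (f : H) (T f)).im = 0 :=
  Complex.conj_eq_iff_im.1 (by rw [inner_conj_symm, hT.symm])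

theorem IsSymm.isDissipative (hT : IsSymm T) : IsDissipative T :=
  ⟨hT.dense, fun f => (hT.im_inner_self f).ge⟩

theorem IsMaxDissipative.inf_domain_le (hT : IsMaxDissipative T) (hTR : T ≤ R)
    {V : Submodule ℂ H} (hTV : T.domain ≤ V)
    (hV : ∀ f : R.domain, (f : H) ∈ V → 0 ≤ (inner ℂ (f : H) (R f)).im) :
    V ⊓ R.domain ≤ T.domain := by
  have hle : T ≤ R.domRestrict V :=
    le_of_le_of_domain_le hTR LinearPMap.domRestrict_le (le_inf hTV hTR.1)
  have hdiss : IsDissipative (R.domRestrict V) :=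
    ⟨hT.1.1.mono hle.1, fun f => by
      rw [← apply_inclusion (T := R) LinearPMap.domRestrict_le f]
      exact hV (Submodule.inclusion LinearPMap.domRestrict_le.1 f) f.2.1⟩
  exact (congrArg LinearPMap.domain (hT.2 _ hdiss hle)).le

variable [CompleteSpace H]

theorem IsDissipative.le_adjoint (hT : IsDissipative T) (hS : IsSymm S) (h : S ≤ T) : T ≤ S† := by
  refine LinearPMap.IsFormalAdjoint.le_adjoint hS.dense fun f g => ?_
  -- Dissipativity on `g + c f` for all scalars `c`: the part linear in `c` has to vanish.
  have hline : ∀ c : ℂ, 0 ≤ (c * (inner ℂ (f : H) (T g) - inner ℂ (S f) (g : H))).im +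
      (inner ℂ (g : H) (T g)).im := fun c => by
    have hpos := hT.2 (Submodule.inclusion h.1 (starRingEnd ℂ c • f) + g)
    have hreal := hS.im_inner_self (starRingEnd ℂ c • f)
    have hcross : (inner ℂ (g : H) (starRingEnd ℂ c • S f)).im =
        -(c * inner ℂ (S f) (g : H)).im := by
      rw [← inner_conj_symm, inner_smul_left, Complex.conj_im, Complex.conj_conj]
    rw [LinearPMap.map_add, apply_inclusion h, LinearPMap.map_smul, Submodule.coe_add,
      Submodule.coe_inclusion, Submodule.coe_smul, inner_add_left, inner_add_right,
      inner_add_right, inner_smul_left _ (T g), Complex.conj_conj] at hpos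
    rw [LinearPMap.map_smul, Submodule.coe_smul] at hreal
    simp only [Complex.add_im, hreal, hcross] at hpos
    rw [mul_sub, Complex.sub_im]
    linarith
  exact (sub_eq_zero.1 (eq_zero_of_forall_im_mul_add_nonneg hline)).symm

theorem isMaxDissipative_of_isSelfAdjoint (hA : IsSelfAdjoint A) : IsMaxDissipative A :=
  have hsymm := isSymm_of_isSelfAdjoint hA
  ⟨hsymm.isDissipative, fun _ hB hAB =>
    le_antisymm ((hB.le_adjoint hsymm hAB).trans_eq hA) hAB⟩

end Dissipative

section Energy

variable {H : Type*} [NormedAddCommGroup H] [InnerProductSpace ℂ H] {T : H →ₗ.[ℂ] H}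

/-- The domain of a nonnegative operator `T`, to be equipped with the semi-inner product
`⟨f, T g⟩`. It is a type synonym because `T.domain` already carries the inner product of `H`. -/
def EnergySpace (_ : IsNonneg T) : Type _ := T.domain

instance (hT : IsNonneg T) : AddCommGroup (EnergySpace hT) :=
  inferInstanceAs (AddCommGroup T.domain)

instance (hT : IsNonneg T) : Module ℂ (EnergySpace hT) :=
  inferInstanceAs (Module ℂ T.domain)

/-- The semi-inner product `⟨f, T g⟩` on the domain of `T`. -/
@[reducible]
def energyCore (hT : IsNonneg T) : PreInnerProductSpace.Core ℂ (EnergySpace hT) where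
  inner f g := inner ℂ ((show T.domain from f) : H) (T g)
  conj_inner_symm f g := (inner_conj_symm _ _).trans (hT.symm f g)
  re_inner_nonneg f := hT.nonneg f
  add_left _ _ _ := inner_add_left _ _ _
  smul_left _ _ _ := inner_smul_left _ _ _

instance (hT : IsNonneg T) : SeminormedAddCommGroup (EnergySpace hT) :=
  letI := energyCore hT
  InnerProductSpace.Core.toSeminormedAddCommGroup (𝕜 := ℂ)

instance (hT : IsNonneg T) : InnerProductSpace ℂ (EnergySpace hT) :=
  InnerProductSpace.ofCore (energyCore hT)

/-- The canonical map from the domain of `T` to the Hilbert space completion of its energy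
space. -/
def toEnergy (hT : IsNonneg T) : T.domain →ₗ[ℂ] Completion (EnergySpace hT) :=
  (Completion.toComplₗᵢ (𝕜 := ℂ) (E := EnergySpace hT)).toLinearMap

theorem inner_toEnergy (hT : IsNonneg T) (f g : T.domain) :
    inner ℂ (toEnergy hT f) (toEnergy hT g) = inner ℂ (f : H) (T g) :=
  Completion.inner_coe (𝕜 := ℂ) (E := EnergySpace hT) f g

theorem norm_toEnergy_sq (hT : IsNonneg T) (f : T.domain) : ‖toEnergy hT f‖ ^ 2 = quad T f := by
  rw [← inner_self_eq_norm_sq (𝕜 := ℂ), inner_toEnergy]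
  rfl

theorem denseRange_toEnergy (hT : IsNonneg T) : DenseRange (toEnergy hT) :=
  Completion.denseRange_coe (α := EnergySpace hT)

theorem exists_seq_tendsto_toEnergy (hT : IsNonneg T) (p : Completion (EnergySpace hT)) :
    ∃ u : ℕ → T.domain, Tendsto (fun n => toEnergy hT (u n)) atTop (𝓝 p) := by
  obtain ⟨v, hv, hlim⟩ := mem_closure_iff_seq_limit.1 (denseRange_toEnergy hT p)
  choose u hu using hv
  exact ⟨u, by simpa only [hu] using hlim⟩

theorem formCauchy_iff_cauchySeq (hT : IsNonneg T) {u : ℕ → T.domain} :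
    FormCauchy T u ↔ CauchySeq fun n => toEnergy hT (u n) := by
  simp only [cauchySeq_iff_tendsto_dist_atTop_0, FormCauchy, ← norm_toEnergy_sq hT, map_sub,
    dist_eq_norm]
  refine ⟨fun h => ?_, fun h => by simpa using h.pow 2⟩
  simpa [Real.sqrt_sq] using h.sqrt

theorem hasFormValue_iff (hT : IsNonneg T) {f : H} {c : ℝ} :
    HasFormValue T f c ↔ ∃ (u : ℕ → T.domain) (p : Completion (EnergySpace hT)),
      Tendsto (fun n => (u n : H)) atTop (𝓝 f) ∧
      Tendsto (fun n => toEnergy hT (u n)) atTop (𝓝 p) ∧ ‖p‖ ^ 2 = c := by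
  constructor
  · rintro ⟨u, hu, hcauchy, hlim⟩
    obtain ⟨p, hp⟩ := cauchySeq_tendsto_of_complete ((formCauchy_iff_cauchySeq hT).1 hcauchy)
    refine ⟨u, p, hu, hp, tendsto_nhds_unique (hp.norm.pow 2) ?_⟩
    simpa only [norm_toEnergy_sq] using hlim
  · rintro ⟨u, p, hu, hp, rfl⟩
    exact ⟨u, hu, (formCauchy_iff_cauchySeq hT).2 hp.cauchySeq,
      by simpa only [norm_toEnergy_sq] using hp.norm.pow 2⟩

theorem IsStrictlyPos.exists_norm_le (hS : IsStrictlyPos T) :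
    ∃ C, ∀ f : T.domain, ‖(f : H)‖ ≤ C * ‖toEnergy hS.isNonneg f‖ := by
  obtain ⟨ε, hε, h⟩ := hS.pos
  refine ⟨√ε⁻¹, fun f => ?_⟩
  rw [← Real.sqrt_sq (norm_nonneg (toEnergy _ f)), ← Real.sqrt_mul (by positivity),
    norm_toEnergy_sq]
  exact Real.le_sqrt_of_sq_le ((le_inv_mul_iff₀ hε).2 (h f))

end Energy

section Embedding

variable {H : Type*} [NormedAddCommGroup H] [InnerProductSpace ℂ H] [CompleteSpace H]
  {S : H →ₗ.[ℂ] H}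

open ContinuousLinearMap (adjoint adjoint_inner_left adjoint_inner_right)

/-- The continuous extension of the inclusion `S.domain → H` to the energy completion of a
strictly positive operator `S`; its range is the form domain of `S`. -/
def IsStrictlyPos.embedding (hS : IsStrictlyPos S) :
    Completion (EnergySpace hS.isNonneg) →L[ℂ] H :=
  S.domain.subtype.extendOfNorm (toEnergy hS.isNonneg)

theorem IsStrictlyPos.embedding_toEnergy (hS : IsStrictlyPos S) (f : S.domain) :
    hS.embedding (toEnergy hS.isNonneg f) = f :=
  LinearMap.extendOfNorm_eq (denseRange_toEnergy _) hS.exists_norm_le f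

theorem IsStrictlyPos.adjoint_embedding_apply (hS : IsStrictlyPos S) (f : S.domain) :
    adjoint hS.embedding (S f) = toEnergy hS.isNonneg f := by
  refine ext_inner_left ℂ fun p => ?_
  rw [adjoint_inner_right]
  refine (denseRange_toEnergy hS.isNonneg).induction_on p
    (isClosed_eq (by fun_prop) (by fun_prop)) fun g => ?_
  rw [hS.embedding_toEnergy, inner_toEnergy]

namespace IsStrictlyPos

theorem hasFormValue_embedding (hS : IsStrictlyPos S) (p : Completion (EnergySpace hS.isNonneg)) :
    HasFormValue S (hS.embedding p) (‖p‖ ^ 2) := by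
  obtain ⟨u, hu⟩ := exists_seq_tendsto_toEnergy hS.isNonneg p
  refine (hasFormValue_iff hS.isNonneg).2 ⟨u, p, ?_, hu, rfl⟩
  simpa only [Function.comp_def, embedding_toEnergy] using
    (hS.embedding.continuous.tendsto p).comp hu

theorem exists_formCauchy_tendsto_iff (hS : IsStrictlyPos S) {f : H} :
    (∃ u : ℕ → S.domain, Tendsto (fun n => (u n : H)) atTop (𝓝 f) ∧ FormCauchy S u) ↔
      ∃ p, hS.embedding p = f := by
  constructor
  · rintro ⟨u, hu, hcauchy⟩
    obtain ⟨p, hp⟩ :=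
      cauchySeq_tendsto_of_complete ((formCauchy_iff_cauchySeq hS.isNonneg).1 hcauchy)
    refine ⟨p, tendsto_nhds_unique ((hS.embedding.continuous.tendsto p).comp hp) ?_⟩
    simpa only [Function.comp_def, embedding_toEnergy] using hu
  · rintro ⟨p, rfl⟩
    obtain ⟨u, hu, hcauchy, -⟩ := hS.hasFormValue_embedding p
    exact ⟨u, hu, hcauchy⟩

theorem adjoint_embedding_adjoint_apply (hS : IsStrictlyPos S) {f : S†.domain}
    {p : Completion (EnergySpace hS.isNonneg)} (hp : hS.embedding p = f) :
    adjoint hS.embedding (S† f) = p := by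
  refine (denseRange_toEnergy hS.isNonneg).eq_of_inner_right ℂ fun x => ?_
  rw [adjoint_inner_right, embedding_toEnergy, ← hS.adjoint_embedding_apply, adjoint_inner_left,
    hp, (LinearPMap.adjoint_isFormalAdjoint hS.dense).symm]

/-- The inverse `J J*` of the Friedrichs extension, `J` being the embedding of the energy
completion. -/
def friedrichsInverse (hS : IsStrictlyPos S) : H →L[ℂ] H :=
  hS.embedding ∘L adjoint hS.embedding

theorem inner_friedrichsInverse_left (hS : IsStrictlyPos S) (f g : H) :
    inner ℂ (hS.friedrichsInverse f) g =
      inner ℂ (adjoint hS.embedding f) (adjoint hS.embedding g) := by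
  rw [friedrichsInverse, ContinuousLinearMap.comp_apply, adjoint_inner_right]

theorem exists_adjoint_friedrichsInverse (hS : IsStrictlyPos S) (g : H) :
    ∃ h : hS.friedrichsInverse g ∈ S†.domain, S† ⟨hS.friedrichsInverse g, h⟩ = g :=
  exists_adjoint_apply_eq hS.dense fun x => by
    rw [inner_friedrichsInverse_left, adjoint_embedding_apply, adjoint_inner_left,
      embedding_toEnergy]

theorem sub_friedrichsInverse_mem_kernel (hS : IsStrictlyPos S) (f : S†.domain) :
    (f : H) - hS.friedrichsInverse (S† f) ∈ kernel S† := by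
  obtain ⟨hmem, hG⟩ := hS.exists_adjoint_friedrichsInverse (S† f)
  exact mem_kernel.2 ⟨sub_mem f.2 hmem,
    (S†.map_sub f ⟨_, hmem⟩).trans (sub_eq_zero.2 hG.symm)⟩

end IsStrictlyPos

theorem friedrichs_le_adjoint (hS : IsNonneg S) : friedrichs S hS ≤ S† :=
  ⟨fun _ hf => hf.1, fun _ _ h => congrArg S†.toFun (Subtype.ext h)⟩

theorem le_friedrichs (hS : IsNonneg S) : S ≤ friedrichs S hS :=
  le_of_le_of_domain_le hS.le_adjoint (friedrichs_le_adjoint hS) fun f hf =>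
    ⟨hS.le_adjoint.1 hf, fun _ => ⟨f, hf⟩, tendsto_const_nhds, formCauchy_const S _⟩

theorem krein_le_adjoint (hS : IsNonneg S) : krein S hS ≤ S† :=
  ⟨fun _ hf => hf.1, fun _ _ h => congrArg S†.toFun (Subtype.ext h)⟩

theorem le_krein (hS : IsNonneg S) : S ≤ krein S hS :=
  le_of_le_of_domain_le hS.le_adjoint (krein_le_adjoint hS) fun f hf =>
    ⟨hS.le_adjoint.1 hf, fun _ => ⟨f, hf⟩, by
      rw [← hS.le_adjoint.2 (x := ⟨f, hf⟩) rfl]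
      exact tendsto_const_nhds, formCauchy_const S _⟩

namespace IsStrictlyPos

section Friedrichs

theorem mem_friedrichs (hS : IsStrictlyPos S) {f : S†.domain} :
    (f : H) ∈ (friedrichs S hS.isNonneg).domain ↔ hS.friedrichsInverse (S† f) = f := by
  change (f : H) ∈ S†.domain ∧ _ ↔ _
  rw [and_iff_right f.2, hS.exists_formCauchy_tendsto_iff]
  exact ⟨fun ⟨p, hp⟩ => by
    rw [friedrichsInverse, ContinuousLinearMap.comp_apply, hS.adjoint_embedding_adjoint_apply hp,
      hp], fun h => ⟨_, h⟩⟩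

theorem friedrichsInverse_friedrichs (hS : IsStrictlyPos S)
    (f : (friedrichs S hS.isNonneg).domain) :
    hS.friedrichsInverse (friedrichs S hS.isNonneg f) = f :=
  (hS.mem_friedrichs (f := ⟨f, (friedrichs_le_adjoint hS.isNonneg).1 f.2⟩)).1 f.2

theorem inner_friedrichs (hS : IsStrictlyPos S) (f g : (friedrichs S hS.isNonneg).domain) :
    inner ℂ (f : H) (friedrichs S hS.isNonneg g) =
      inner ℂ (adjoint hS.embedding (friedrichs S hS.isNonneg f))
        (adjoint hS.embedding (friedrichs S hS.isNonneg g)) := by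
  rw [← hS.inner_friedrichsInverse_left, hS.friedrichsInverse_friedrichs]

theorem quad_friedrichs (hS : IsStrictlyPos S) (f : (friedrichs S hS.isNonneg).domain) :
    quad (friedrichs S hS.isNonneg) f =
      ‖adjoint hS.embedding (friedrichs S hS.isNonneg f)‖ ^ 2 := by
  rw [quad, hS.inner_friedrichs]
  exact inner_self_eq_norm_sq (𝕜 := ℂ) _

theorem surjective_friedrichs (hS : IsStrictlyPos S) :
    Function.Surjective (friedrichs S hS.isNonneg) := fun g => by
  obtain ⟨hmem, hG⟩ := hS.exists_adjoint_friedrichsInverse g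
  exact ⟨⟨_, hS.mem_friedrichs.2 (congrArg hS.friedrichsInverse hG)⟩, hG⟩

theorem isSelfAdjoint_friedrichs (hS : IsStrictlyPos S) :
    IsSelfAdjoint (friedrichs S hS.isNonneg) :=
  IsSymm.isSelfAdjoint_of_surjective
    { dense := hS.dense.mono (le_friedrichs hS.isNonneg).1
      symm := fun f g => by
        rw [← inner_conj_symm, hS.inner_friedrichs, inner_conj_symm, hS.inner_friedrichs] }
    hS.surjective_friedrichs

theorem isNonnegSelfAdjointExt_friedrichs (hS : IsStrictlyPos S) :
    IsNonnegSelfAdjointExt S (friedrichs S hS.isNonneg) :=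
  ⟨le_friedrichs hS.isNonneg, hS.isSelfAdjoint_friedrichs, fun f => by
    rw [hS.quad_friedrichs]
    positivity⟩

theorem hasFormValue_of_friedrichs (hS : IsStrictlyPos S) {f : H} {c : ℝ}
    (h : HasFormValue (friedrichs S hS.isNonneg) f c) : HasFormValue S f c := by
  obtain ⟨u, hu, hcauchy, hlim⟩ := h
  set p := fun n => adjoint hS.embedding (friedrichs S hS.isNonneg (u n)) with hp
  have hpcauchy : CauchySeq p := by
    rw [cauchySeq_iff_tendsto_dist_atTop_0]
    simpa [hp, FormCauchy, hS.quad_friedrichs, LinearPMap.map_sub, dist_eq_norm] using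
      hcauchy.sqrt
  obtain ⟨q, hq⟩ := cauchySeq_tendsto_of_complete hpcauchy
  have hf : hS.embedding q = f :=
    tendsto_nhds_unique ((hS.embedding.continuous.tendsto q).comp hq)
      (hu.congr fun n => (hS.friedrichsInverse_friedrichs (u n)).symm)
  have hc : ‖q‖ ^ 2 = c :=
    tendsto_nhds_unique (hq.norm.pow 2) (hlim.congr fun n => hS.quad_friedrichs (u n))
  rw [← hf, ← hc]
  exact hS.hasFormValue_embedding q

theorem isLargestExt_friedrichs (hS : IsStrictlyPos S) :
    IsLargestExt S (friedrichs S hS.isNonneg) :=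
  ⟨hS.isNonnegSelfAdjointExt_friedrichs, fun _ hB _ c h =>
    ⟨c, le_rfl, (hS.hasFormValue_of_friedrichs h).mono hB.1⟩⟩

end Friedrichs

section Krein

theorem mem_krein (hS : IsStrictlyPos S) {f : S†.domain} :
    (f : H) ∈ (krein S hS.isNonneg).domain ↔ ∀ k ∈ kernel S†, inner ℂ k (S† f) = 0 := by
  constructor
  · rintro ⟨_, u, hu, -⟩ k hk
    refine tendsto_nhds_unique (tendsto_const_nhds.inner hu) ?_
    simpa only [(mem_kernel_adjoint hS.dense).1 hk] using tendsto_const_nhds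
  · intro h
    have hclosure : S† f ∈ closure (Set.range S) := by
      have : S† f ∈ (LinearMap.range S.toFun)ᗮᗮ := by
        rwa [← kernel_adjoint_eq_orthogonal hS.dense]
      rwa [Submodule.orthogonal_orthogonal_eq_closure] at this
    obtain ⟨v, hv, hlim⟩ := mem_closure_iff_seq_limit.1 hclosure
    choose u hu using hv
    obtain rfl : (fun n => S (u n)) = v := funext hu
    refine ⟨f.2, u, hlim, (formCauchy_iff_cauchySeq hS.isNonneg).2 ?_⟩
    simpa only [← hS.adjoint_embedding_apply, Function.comp_def] using
      (((adjoint hS.embedding).continuous.tendsto _).comp hlim).cauchySeq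

theorem mem_krein_of_mem_kernel (hS : IsStrictlyPos S) {k : H} (hk : k ∈ kernel S†) :
    ∃ h : k ∈ (krein S hS.isNonneg).domain, krein S hS.isNonneg ⟨k, h⟩ = 0 := by
  obtain ⟨hmem, h0⟩ := mem_kernel.1 hk
  exact ⟨(hS.mem_krein (f := ⟨k, hmem⟩)).2 fun _ _ => by rw [h0, inner_zero_right], h0⟩

theorem inner_krein (hS : IsStrictlyPos S) (f : S†.domain) (g : (krein S hS.isNonneg).domain) :
    inner ℂ (f : H) (krein S hS.isNonneg g) =
      inner ℂ (adjoint hS.embedding (S† f))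
        (adjoint hS.embedding (krein S hS.isNonneg g)) := by
  have h := (hS.mem_krein (f := ⟨g, (krein_le_adjoint hS.isNonneg).1 g.2⟩)).1 g.2 _
    (hS.sub_friedrichsInverse_mem_kernel f)
  rwa [inner_sub_left, inner_friedrichsInverse_left, sub_eq_zero] at h

theorem isSymm_krein (hS : IsStrictlyPos S) : IsSymm (krein S hS.isNonneg) where
  dense := hS.dense.mono (le_krein hS.isNonneg).1
  symm f g := by
    have hfg := hS.inner_krein ⟨f, (krein_le_adjoint hS.isNonneg).1 f.2⟩ g
    have hgf := hS.inner_krein ⟨g, (krein_le_adjoint hS.isNonneg).1 g.2⟩ f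
    rw [← inner_conj_symm, hgf, inner_conj_symm]
    exact hfg.symm

theorem isSelfAdjoint_krein (hS : IsStrictlyPos S) : IsSelfAdjoint (krein S hS.isNonneg) := by
  refine hS.isSymm_krein.isSelfAdjoint fun f hf => ?_
  have hle := adjoint_le_adjoint hS.dense (le_krein hS.isNonneg)
  refine (hS.mem_krein (f := ⟨f, hle.1 hf⟩)).2 fun k hk => ?_
  obtain ⟨hmem, h0⟩ := hS.mem_krein_of_mem_kernel hk
  rw [← hle.2 (x := ⟨f, hf⟩) rfl, ← inner_conj_symm,
    LinearPMap.adjoint_isFormalAdjoint hS.isSymm_krein.dense ⟨f, hf⟩ ⟨k, hmem⟩, h0,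
    inner_zero_right, map_zero]

theorem quad_krein (hS : IsStrictlyPos S) (f : (krein S hS.isNonneg).domain) :
    quad (krein S hS.isNonneg) f = ‖adjoint hS.embedding (krein S hS.isNonneg f)‖ ^ 2 :=
  (congrArg Complex.re (hS.inner_krein ⟨f, (krein_le_adjoint hS.isNonneg).1 f.2⟩ f)).trans
    (inner_self_eq_norm_sq (𝕜 := ℂ) (adjoint hS.embedding (krein S hS.isNonneg f)))

theorem isNonnegSelfAdjointExt_krein (hS : IsStrictlyPos S) :
    IsNonnegSelfAdjointExt S (krein S hS.isNonneg) :=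
  ⟨le_krein hS.isNonneg, hS.isSelfAdjoint_krein, fun f => by
    rw [hS.quad_krein]
    positivity⟩

theorem friedrichs_ne_krein (hS : IsStrictlyPos S) (h : kernel S† ≠ ⊥) :
    friedrichs S hS.isNonneg ≠ krein S hS.isNonneg := fun heq => by
  refine h (eq_bot_iff.2 fun k hk => ?_)
  obtain ⟨hmem, h0⟩ := hS.mem_krein_of_mem_kernel hk
  have hfix := hS.friedrichsInverse_friedrichs ⟨k, heq ▸ hmem⟩
  rwa [show friedrichs S hS.isNonneg ⟨k, heq ▸ hmem⟩ = 0 from h0, map_zero, eq_comm] at hfix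

end Krein

end IsStrictlyPos

end Embedding

section Smallest

variable {H : Type*} [NormedAddCommGroup H] [InnerProductSpace ℂ H] {B S T : H →ₗ.[ℂ] H}

theorem HasFormValue.add_mem_kernel (hT : IsSymm T) {f k : H} {c : ℝ} (hf : HasFormValue T f c)
    (hk : k ∈ kernel T) : HasFormValue T (f + k) c := by
  obtain ⟨hmem, h0⟩ := mem_kernel.1 hk
  obtain ⟨u, hu, hcauchy, hlim⟩ := hf
  have hquad : ∀ g : T.domain, quad T (g + ⟨k, hmem⟩) = quad T g := fun g => by
    rw [quad, LinearPMap.map_add, h0, add_zero, Submodule.coe_add, inner_add_left,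
      ← hT.symm ⟨k, hmem⟩, h0, inner_zero_left, add_zero, quad]
  refine ⟨fun n => u n + ⟨k, hmem⟩, hu.add_const k, ?_, ?_⟩
  · simpa only [FormCauchy, add_sub_add_right_eq_sub] using hcauchy
  · simpa only [hquad] using hlim

/-- The isometry of energy completions induced by an extension `S ≤ B`. -/
def energyMap (hS : IsNonneg S) (hB : IsNonneg B) (h : S ≤ B) :
    Completion (EnergySpace hS) →L[ℂ] Completion (EnergySpace hB) :=
  (toEnergy hB ∘ₗ Submodule.inclusion h.1).extendOfNorm (toEnergy hS)

theorem norm_toEnergy_inclusion (hS : IsNonneg S) (hB : IsNonneg B) (h : S ≤ B) (f : S.domain) :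
    ‖toEnergy hB (Submodule.inclusion h.1 f)‖ = ‖toEnergy hS f‖ :=
  (sq_eq_sq₀ (norm_nonneg _) (norm_nonneg _)).1 <| by
    rw [norm_toEnergy_sq, norm_toEnergy_sq, quad_inclusion h]

theorem energyMap_toEnergy (hS : IsNonneg S) (hB : IsNonneg B) (h : S ≤ B) (f : S.domain) :
    energyMap hS hB h (toEnergy hS f) = toEnergy hB (Submodule.inclusion h.1 f) :=
  LinearMap.extendOfNorm_eq (denseRange_toEnergy hS)
    ⟨1, fun g => ((norm_toEnergy_inclusion hS hB h g).trans (one_mul _).symm).le⟩ f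

theorem norm_energyMap_le (hS : IsNonneg S) (hB : IsNonneg B) (h : S ≤ B) :
    ‖energyMap hS hB h‖ ≤ 1 :=
  LinearMap.opNorm_extendOfNorm_le (denseRange_toEnergy hS) zero_le_one
    fun g => ((norm_toEnergy_inclusion hS hB h g).trans (one_mul _).symm).le

theorem HasFormValue.exists_inner_toEnergy_eq (hS : IsNonneg S) (hB : IsNonneg B) (h : S ≤ B)
    {f : H} {c : ℝ} (hf : HasFormValue B f c) :
    ∃ p : Completion (EnergySpace hS), ‖p‖ ^ 2 ≤ c ∧
      ∀ x : S.domain, inner ℂ p (toEnergy hS x) = inner ℂ f (S x) := by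
  obtain ⟨u, q, hu, hq, rfl⟩ := (hasFormValue_iff hB).1 hf
  refine ⟨ContinuousLinearMap.adjoint (energyMap hS hB h) q, ?_, fun x => ?_⟩
  · gcongr
    refine (ContinuousLinearMap.le_opNorm _ q).trans (mul_le_of_le_one_left (norm_nonneg q) ?_)
    rw [LinearIsometryEquiv.norm_map]
    exact norm_energyMap_le hS hB h
  · rw [ContinuousLinearMap.adjoint_inner_left, energyMap_toEnergy]
    refine tendsto_nhds_unique (hq.inner tendsto_const_nhds)
      ((hu.inner tendsto_const_nhds).congr fun n => ?_)
    rw [inner_toEnergy, apply_inclusion h]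

variable [CompleteSpace H]

namespace IsStrictlyPos

theorem hasFormValue_krein (hS : IsStrictlyPos S) {f : H}
    {p : Completion (EnergySpace hS.isNonneg)}
    (h : ∀ x : S.domain, inner ℂ p (toEnergy hS.isNonneg x) = inner ℂ f (S x)) :
    HasFormValue (krein S hS.isNonneg) f (‖p‖ ^ 2) := by
  have hker : f - hS.embedding p ∈ kernel S† := (mem_kernel_adjoint hS.dense).2 fun x => by
    rw [inner_sub_left, ← ContinuousLinearMap.adjoint_inner_right, hS.adjoint_embedding_apply, h,
      sub_self]
  rw [← add_sub_cancel (hS.embedding p) f]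
  exact ((hS.hasFormValue_embedding p).mono (le_krein hS.isNonneg)).add_mem_kernel hS.isSymm_krein
    (mem_kernel.2 (hS.mem_krein_of_mem_kernel hker))

theorem isSmallestExt_krein (hS : IsStrictlyPos S) : IsSmallestExt S (krein S hS.isNonneg) := by
  refine ⟨hS.isNonnegSelfAdjointExt_krein, fun B ⟨hSB, hsa, hnonneg⟩ f c hf => ?_⟩
  obtain ⟨p, hp, hinner⟩ :=
    hf.exists_inner_toEnergy_eq hS.isNonneg ⟨isSymm_of_isSelfAdjoint hsa, hnonneg⟩ hSB
  exact ⟨_, hp, hS.hasFormValue_krein hinner⟩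

end IsStrictlyPos

end Smallest

section KInvariance

variable {H : Type*} [NormedAddCommGroup H] [InnerProductSpace ℂ H] [CompleteSpace H]
  {R S T : H →ₗ.[ℂ] H}

open ContinuousLinearMap (adjoint adjoint_inner_left adjoint_inner_right)

theorem conj_apply (K : H →L[ℂ] H) (T : H →ₗ.[ℂ] H) (f : (conj K T).domain) :
    conj K T f = adjoint K (T ⟨K f, f.2⟩) :=
  rfl

theorem conj_mono (K : H →L[ℂ] H) (h : T ≤ R) : conj K T ≤ conj K R :=
  ⟨fun _ hf => h.1 hf, fun _ _ hfg =>
    congrArg (adjoint K) (h.2 (congrArg K hfg))⟩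

theorem conj_one (T : H →ₗ.[ℂ] H) : conj 1 T = T :=
  LinearPMap.ext rfl fun _ _ _ => by
    rw [conj_apply, ← ContinuousLinearMap.star_eq_adjoint, star_one]
    rfl

theorem conj_conj (K L : H →L[ℂ] H) (T : H →ₗ.[ℂ] H) : conj L (conj K T) = conj (K * L) T :=
  LinearPMap.ext rfl fun _ _ _ => by
    rw [conj_apply, conj_apply, conj_apply, ← ContinuousLinearMap.comp_apply,
      ← ContinuousLinearMap.adjoint_comp]
    rfl

theorem conj_adjoint_le (K : H →L[ℂ] H) (hT : Dense (T.domain : Set H))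
    (hKT : Dense ((conj K T).domain : Set H)) : conj K T† ≤ (conj K T)† :=
  LinearPMap.IsFormalAdjoint.le_adjoint hKT fun f g => by
    rw [conj_apply, conj_apply, adjoint_inner_left, adjoint_inner_right]
    exact (LinearPMap.adjoint_isFormalAdjoint hT).symm ⟨K f, f.2⟩ ⟨K g, g.2⟩

namespace IsKInvariant

variable {K : H →L[ℂ] H}

theorem map_mem_iff (hT : IsKInvariant K T) {f : H} : K f ∈ T.domain ↔ f ∈ T.domain :=
  SetLike.ext_iff.1 (congrArg LinearPMap.domain hT) f

/-- The restriction of `K` to the domain of a `K`-invariant operator. -/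
def map (hT : IsKInvariant K T) : T.domain →ₗ[ℂ] T.domain :=
  (K : H →ₗ[ℂ] H).restrict fun _ => hT.map_mem_iff.2

theorem adjoint_apply_map (hT : IsKInvariant K T) (f : T.domain) :
    adjoint K (T (hT.map f)) = T f :=
  hT.le.2 (x := ⟨f, hT.map_mem_iff.2 f.2⟩) rfl

theorem inner_apply_map (hT : IsKInvariant K T) (g : H) (f : T.domain) :
    inner ℂ (K g) (T (hT.map f)) = inner ℂ g (T f) := by
  rw [← adjoint_inner_right, hT.adjoint_apply_map]

theorem formCauchy_map (hT : IsKInvariant K T) {u : ℕ → T.domain} (hu : FormCauchy T u) :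
    FormCauchy T fun n => hT.map (u n) :=
  hu.congr fun p => by
    rw [← map_sub]
    exact congrArg Complex.re (hT.inner_apply_map _ _).symm

theorem iff_of_le (hR : IsKInvariant K R) (h : T ≤ R) :
    IsKInvariant K T ↔ ∀ f, K f ∈ T.domain ↔ f ∈ T.domain :=
  ⟨fun hT _ => hT.map_mem_iff, fun hdom =>
    eq_of_le_of_domain_eq ((conj_mono K h).trans_eq hR) h (Submodule.ext hdom)⟩

end IsKInvariant

namespace IsKInvariant

variable {K : (H →L[ℂ] H)ˣ}

theorem inv (hT : IsKInvariant (K : H →L[ℂ] H) T) : IsKInvariant (↑K⁻¹ : H →L[ℂ] H) T := by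
  have h := conj_conj (K : H →L[ℂ] H) ↑K⁻¹ T
  rwa [K.mul_inv, conj_one, show conj (K : H →L[ℂ] H) T = T from hT] at h

theorem iff_of_le_of_inv (hR : IsKInvariant (K : H →L[ℂ] H) R) (h : T ≤ R)
    (hmap : ∀ f ∈ T.domain, (K : H →L[ℂ] H) f ∈ T.domain)
    (hinv : ∀ f ∈ T.domain, (↑K⁻¹ : H →L[ℂ] H) f ∈ T.domain) :
    IsKInvariant (K : H →L[ℂ] H) T :=
  (hR.iff_of_le h).2 fun f => ⟨fun hf => by
    have := hinv _ hf
    rwa [← mul_apply_eq_comp, K.inv_mul] at this, hmap f⟩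

theorem adjoint (hT : IsKInvariant (K : H →L[ℂ] H) T) (hdense : Dense (T.domain : Set H)) :
    IsKInvariant (K : H →L[ℂ] H) T† := by
  have hle : ∀ {L : H →L[ℂ] H}, IsKInvariant L T → conj L T† ≤ T† := fun {L} hL => by
    have h := conj_adjoint_le L hdense
    rw [show conj L T = T from hL] at h
    exact h hdense
  refine le_antisymm (hle hT) ?_
  have h := conj_mono (K : H →L[ℂ] H) (hle hT.inv)
  rwa [conj_conj, K.inv_mul, conj_one] at h

theorem map_mem_kernel (hT : IsKInvariant (K : H →L[ℂ] H) T) {f : H} (hf : f ∈ kernel T) :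
    (K : H →L[ℂ] H) f ∈ kernel T := by
  obtain ⟨hmem, h0⟩ := mem_kernel.1 hf
  refine mem_kernel.2 ⟨hT.map_mem_iff.2 hmem, ext_inner_left ℂ fun g => ?_⟩
  have h := hT.inner_apply_map ((↑K⁻¹ : H →L[ℂ] H) g) ⟨f, hmem⟩
  rw [← mul_apply_eq_comp, K.mul_inv, h0, inner_zero_right] at h
  exact h.trans (inner_zero_right g).symm

theorem map_mem_friedrichs (hKS : IsKInvariant (K : H →L[ℂ] H) S) (hS : IsNonneg S) {f : H}
    (hf : f ∈ (friedrichs S hS).domain) : (K : H →L[ℂ] H) f ∈ (friedrichs S hS).domain := by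
  obtain ⟨hf, u, hu, hcauchy⟩ := hf
  exact ⟨(hKS.adjoint hS.dense).map_mem_iff.2 hf, fun n => hKS.map (u n),
    ((K : H →L[ℂ] H).continuous.tendsto f).comp hu, hKS.formCauchy_map hcauchy⟩

theorem friedrichs (hKS : IsKInvariant (K : H →L[ℂ] H) S) (hS : IsNonneg S) :
    IsKInvariant (K : H →L[ℂ] H) (friedrichs S hS) :=
  (hKS.adjoint hS.dense).iff_of_le_of_inv (friedrichs_le_adjoint hS)
    (fun _ => hKS.map_mem_friedrichs hS) fun _ => hKS.inv.map_mem_friedrichs hS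

theorem map_mem_krein (hKS : IsKInvariant (K : H →L[ℂ] H) S) (hS : IsStrictlyPos S) {f : H}
    (hf : f ∈ (krein S hS.isNonneg).domain) :
    (K : H →L[ℂ] H) f ∈ (krein S hS.isNonneg).domain := by
  have hinv := hKS.adjoint hS.dense
  refine (hS.mem_krein (f := hinv.map ⟨f, hf.1⟩)).2 fun k hk => ?_
  have hk' : (↑K⁻¹ : H →L[ℂ] H) k ∈ kernel S† := (hKS.inv.adjoint hS.dense).map_mem_kernel hk
  have h := hinv.inner_apply_map ((↑K⁻¹ : H →L[ℂ] H) k) ⟨f, hf.1⟩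
  rw [← mul_apply_eq_comp, K.mul_inv] at h
  exact h.trans ((hS.mem_krein (f := ⟨f, hf.1⟩)).1 hf _ hk')

theorem krein (hKS : IsKInvariant (K : H →L[ℂ] H) S) (hS : IsStrictlyPos S) :
    IsKInvariant (K : H →L[ℂ] H) (krein S hS.isNonneg) :=
  (hKS.adjoint hS.dense).iff_of_le_of_inv (krein_le_adjoint hS.isNonneg)
    (fun _ => hKS.map_mem_krein hS) fun _ => hKS.inv.map_mem_krein hS

end IsKInvariant

end KInvariance

theorem eq_top_of_diagonal_mem {𝕜 : Type*} [Field 𝕜] {W : Submodule 𝕜 (𝕜 × 𝕜)} {a b : 𝕜}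
    (hab : a ≠ b) (hW : ∀ p ∈ W, (a * p.1, b * p.2) ∈ W) {p q : 𝕜 × 𝕜} (hp : p ∈ W) (hq : q ∈ W)
    (hp₁ : p.1 ≠ 0) (hq₂ : q.2 ≠ 0) : W = ⊤ := by
  have hfst : ((1, 0) : 𝕜 × 𝕜) ∈ W := by
    have h := W.smul_mem ((a - b) * p.1)⁻¹ (sub_mem (hW p hp) (W.smul_mem b hp))
    have hne : (a - b) * p.1 ≠ 0 := mul_ne_zero (sub_ne_zero.2 hab) hp₁
    convert h using 1
    ext <;> simp [← sub_mul, -mul_inv_rev, hne]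
  have hsnd : ((0, 1) : 𝕜 × 𝕜) ∈ W := by
    have h := W.smul_mem ((b - a) * q.2)⁻¹ (sub_mem (hW q hq) (W.smul_mem a hq))
    have hne : (b - a) * q.2 ≠ 0 := mul_ne_zero (sub_ne_zero.2 hab.symm) hq₂
    convert h using 1
    ext <;> simp [← sub_mul, -mul_inv_rev, hne]
  refine eq_top_iff.2 fun r _ => ?_
  simpa using add_mem (W.smul_mem r.1 hfst) (W.smul_mem r.2 hsnd)

theorem inv_conj_eq_self_iff {𝕜 : Type*} [RCLike 𝕜] {z : 𝕜} (hz : z ≠ 0) :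
    (starRingEnd 𝕜 z)⁻¹ = z ↔ ‖z‖ = 1 := by
  rw [← mul_eq_one_iff_inv_eq₀ ((map_ne_zero _).2 hz), RCLike.conj_mul]
  norm_cast
  exact pow_eq_one_iff_of_nonneg (norm_nonneg z) two_ne_zero

section BoundaryValues

variable {H : Type*} [NormedAddCommGroup H] [InnerProductSpace ℂ H] [CompleteSpace H]
  {S T : H →ₗ.[ℂ] H} {η : H} {ζ : ℂ}

/-- The boundary values `(⟨η, S† f⟩, ⟨η, f - S_F⁻¹ S† f⟩)` of `f` in the domain of `S†`. When the
unit vector `η` spans the kernel of `S†`, the vectors with vanishing first (second) boundary value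
form the domain of the Krein (Friedrichs) extension. -/
def boundaryMap (hS : IsStrictlyPos S) (η : H) : S†.domain →ₗ[ℂ] ℂ × ℂ :=
  ((innerSL ℂ η : H →ₗ[ℂ] ℂ) ∘ₗ S†.toFun).prod
    ((innerSL ℂ η : H →ₗ[ℂ] ℂ) ∘ₗ
      (S†.domain.subtype - (hS.friedrichsInverse : H →ₗ[ℂ] H) ∘ₗ S†.toFun))

theorem boundaryMap_fst (hS : IsStrictlyPos S) (f : S†.domain) :
    (boundaryMap hS η f).1 = inner ℂ η (S† f) :=
  rfl

theorem boundaryMap_snd (hS : IsStrictlyPos S) (f : S†.domain) :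
    (boundaryMap hS η f).2 = inner ℂ η ((f : H) - hS.friedrichsInverse (S† f)) :=
  rfl

theorem boundaryMap_of_apply_eq_zero (hS : IsStrictlyPos S) (hη : ‖η‖ = 1) {hmem : η ∈ S†.domain}
    (h0 : S† ⟨η, hmem⟩ = 0) : boundaryMap hS η ⟨η, hmem⟩ = (0, 1) := by
  refine Prod.ext ?_ ?_
  · rw [boundaryMap_fst, h0, inner_zero_right]
  · rw [boundaryMap_snd, h0, map_zero, sub_zero, inner_self_eq_norm_sq_to_K, hη]
    simp

theorem sub_friedrichsInverse_eq_smul (hS : IsStrictlyPos S) (hη : ‖η‖ = 1)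
    (hker : kernel S† = Submodule.span ℂ {η}) (f : S†.domain) :
    (f : H) - hS.friedrichsInverse (S† f) = (boundaryMap hS η f).2 • η := by
  have hmem := hS.sub_friedrichsInverse_mem_kernel f
  obtain ⟨c, hc⟩ := Submodule.mem_span_singleton.1 (hker ▸ hmem)
  rw [boundaryMap_snd, ← hc, inner_smul_right, inner_self_eq_norm_sq_to_K, hη]
  simp

theorem mem_friedrichs_iff_boundaryMap (hS : IsStrictlyPos S) (hη : ‖η‖ = 1)
    (hker : kernel S† = Submodule.span ℂ {η}) {f : S†.domain} :
    (f : H) ∈ (friedrichs S hS.isNonneg).domain ↔ (boundaryMap hS η f).2 = 0 := by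
  have hη₀ : η ≠ 0 := norm_ne_zero_iff.1 (hη ▸ one_ne_zero)
  rw [hS.mem_friedrichs, eq_comm, ← sub_eq_zero, sub_friedrichsInverse_eq_smul hS hη hker,
    smul_eq_zero_iff_left hη₀]

theorem mem_krein_iff_boundaryMap (hS : IsStrictlyPos S)
    (hker : kernel S† = Submodule.span ℂ {η}) {f : S†.domain} :
    (f : H) ∈ (krein S hS.isNonneg).domain ↔ (boundaryMap hS η f).1 = 0 := by
  rw [hS.mem_krein, hker, boundaryMap_fst]
  refine ⟨fun h => h η (Submodule.mem_span_singleton_self η), fun h k hk => ?_⟩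
  obtain ⟨c, rfl⟩ := Submodule.mem_span_singleton.1 hk
  rw [inner_smul_left, h, mul_zero]

theorem im_inner_adjoint_apply (hS : IsStrictlyPos S) (hη : ‖η‖ = 1)
    (hker : kernel S† = Submodule.span ℂ {η}) (f : S†.domain) :
    (inner ℂ (f : H) (S† f)).im =
      (starRingEnd ℂ (boundaryMap hS η f).2 * (boundaryMap hS η f).1).im := by
  conv_lhs => rw [← sub_add_cancel (f : H) (hS.friedrichsInverse (S† f))]
  rw [sub_friedrichsInverse_eq_smul hS hη hker, inner_add_left, inner_smul_left,
    hS.inner_friedrichsInverse_left, Complex.add_im, ← boundaryMap_fst hS]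
  exact add_eq_left.2 (inner_self_im (𝕜 := ℂ) _)

theorem IsDissipative.im_boundaryMap_nonneg (hT : IsDissipative T) (hST : S ≤ T)
    (hS : IsStrictlyPos S) (hη : ‖η‖ = 1) (hker : kernel S† = Submodule.span ℂ {η})
    {f : S†.domain} (hf : (f : H) ∈ T.domain) :
    0 ≤ (starRingEnd ℂ (boundaryMap hS η f).2 * (boundaryMap hS η f).1).im := by
  have h := hT.2 ⟨f, hf⟩
  rwa [(hT.le_adjoint hS.toIsSymm hST).2 (y := f) rfl, im_inner_adjoint_apply hS hη hker] at h

theorem IsMaxDissipative.mem_of_boundaryMap_eq_zero (hT : IsMaxDissipative T) (hST : S ≤ T)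
    (hS : IsStrictlyPos S) (hη : ‖η‖ = 1) (hker : kernel S† = Submodule.span ℂ {η})
    {f : S†.domain} (hf : boundaryMap hS η f = 0) : (f : H) ∈ T.domain := by
  have hTS := hT.1.le_adjoint hS.toIsSymm hST
  set N := (LinearMap.ker (boundaryMap hS η)).map S†.domain.subtype
  refine hT.inf_domain_le hTS (V := T.domain ⊔ N) le_sup_left (fun g hg => ?_)
    ⟨Submodule.mem_sup_right ⟨f, hf, rfl⟩, f.2⟩
  obtain ⟨t, ht, _, ⟨k, hk, rfl⟩, htk⟩ := Submodule.mem_sup.1 hg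
  obtain rfl : ⟨t, hTS.1 ht⟩ + k = g := Subtype.ext htk
  rw [im_inner_adjoint_apply hS hη hker, map_add, LinearMap.mem_ker.1 hk, add_zero]
  exact hT.1.im_boundaryMap_nonneg hST hS hη hker ht

section Invariance

variable {K : (H →L[ℂ] H)ˣ}

theorem IsKInvariant.exists_ne_zero_apply_eq_smul (hKS : IsKInvariant (K : H →L[ℂ] H) S)
    (hdense : Dense (S.domain : Set H)) (hη : η ≠ 0)
    (hker : kernel S† = Submodule.span ℂ {η}) : ∃ ζ : ℂ, ζ ≠ 0 ∧ (K : H →L[ℂ] H) η = ζ • η := by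
  have hmem := (hKS.adjoint hdense).map_mem_kernel (hker ▸ Submodule.mem_span_singleton_self η)
  obtain ⟨ζ, hζ⟩ := Submodule.mem_span_singleton.1 (hker ▸ hmem)
  refine ⟨ζ, ?_, hζ.symm⟩
  rintro rfl
  exact hη ((ContinuousLinearEquiv.unitsEquiv ℂ H K).map_eq_zero_iff.1
    (hζ.symm.trans (zero_smul ℂ η)))

theorem boundaryMap_map_fst (hS : IsStrictlyPos S)
    (hK : IsKInvariant (K : H →L[ℂ] H) S†) (hζ : (K : H →L[ℂ] H) η = ζ • η) (f : S†.domain) :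
    starRingEnd ℂ ζ * (boundaryMap hS η (hK.map f)).1 = (boundaryMap hS η f).1 := by
  rw [boundaryMap_fst, boundaryMap_fst, ← inner_smul_left, ← hζ, hK.inner_apply_map]

theorem boundaryMap_map_snd (hS : IsStrictlyPos S) (hη : ‖η‖ = 1)
    (hker : kernel S† = Submodule.span ℂ {η}) (hKS : IsKInvariant (K : H →L[ℂ] H) S)
    (hζ : (K : H →L[ℂ] H) η = ζ • η) (f : S†.domain) :
    (boundaryMap hS η ((hKS.adjoint hS.dense).map f)).2 = ζ * (boundaryMap hS η f).2 := by
  set map := (hKS.adjoint hS.dense).map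
  obtain ⟨hmem, h0⟩ := mem_kernel.1 (hker ▸ Submodule.mem_span_singleton_self η)
  have hmapη : map ⟨η, hmem⟩ = ζ • ⟨η, hmem⟩ := Subtype.ext hζ
  have hΓη := boundaryMap_of_apply_eq_zero hS hη h0
  -- `f - b η` lies in the domain of the Friedrichs extension, which `K` preserves.
  have hF : (boundaryMap hS η (f - (boundaryMap hS η f).2 • ⟨η, hmem⟩)).2 = 0 := by
    rw [map_sub, map_smul, hΓη]
    simp
  have hKF := (mem_friedrichs_iff_boundaryMap hS hη hker (f := map _)).1 <|
    hKS.map_mem_friedrichs hS.isNonneg ((mem_friedrichs_iff_boundaryMap hS hη hker).2 hF)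
  rw [map_sub, map_smul, hmapη, map_sub, map_smul, map_smul, hΓη] at hKF
  simpa [sub_eq_zero, mul_comm] using hKF

theorem boundaryMap_map (hS : IsStrictlyPos S) (hη : ‖η‖ = 1)
    (hker : kernel S† = Submodule.span ℂ {η}) (hKS : IsKInvariant (K : H →L[ℂ] H) S)
    (hζ₀ : ζ ≠ 0) (hζ : (K : H →L[ℂ] H) η = ζ • η) (f : S†.domain) :
    boundaryMap hS η ((hKS.adjoint hS.dense).map f) =
      ((starRingEnd ℂ ζ)⁻¹ * (boundaryMap hS η f).1, ζ * (boundaryMap hS η f).2) :=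
  Prod.ext ((eq_inv_mul_iff_mul_eq₀ ((map_ne_zero _).2 hζ₀)).2
    (boundaryMap_map_fst hS (hKS.adjoint hS.dense) hζ f)) (boundaryMap_map_snd hS hη hker hKS hζ f)

theorem IsDissipative.le_friedrichs_or_le_krein (hT : IsDissipative T) (hST : S ≤ T)
    (hKT : IsKInvariant (K : H →L[ℂ] H) T) (hS : IsStrictlyPos S) (hη : ‖η‖ = 1)
    (hker : kernel S† = Submodule.span ℂ {η}) (hKS : IsKInvariant (K : H →L[ℂ] H) S)
    (hζ₀ : ζ ≠ 0) (hζ : (K : H →L[ℂ] H) η = ζ • η) (hζ₁ : ‖ζ‖ ≠ 1) :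
    T ≤ friedrichs S hS.isNonneg ∨ T ≤ krein S hS.isNonneg := by
  have hTS := hT.le_adjoint hS.toIsSymm hST
  by_contra! hnot
  have hF : ∃ f : T.domain, (f : H) ∉ (friedrichs S hS.isNonneg).domain := by
    by_contra! h
    exact hnot.1 (le_of_le_of_domain_le hTS (friedrichs_le_adjoint _) fun f hf => h ⟨f, hf⟩)
  have hK : ∃ f : T.domain, (f : H) ∉ (krein S hS.isNonneg).domain := by
    by_contra! h
    exact hnot.2 (le_of_le_of_domain_le hTS (krein_le_adjoint _) fun f hf => h ⟨f, hf⟩)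
  obtain ⟨f, hf⟩ := hF
  obtain ⟨g, hg⟩ := hK
  set Γ := boundaryMap hS η
  -- The boundary values of `T` form a subspace invariant under `diag(1 / ζ̄, ζ)`, and not
  -- contained in either eigenspace.
  have htop : (T.domain.comap S†.domain.subtype).map Γ = ⊤ := by
    refine eq_top_of_diagonal_mem ((inv_conj_eq_self_iff hζ₀).not.2 hζ₁) ?_
      (Submodule.mem_map_of_mem (f := Γ) (r := ⟨g, hTS.1 g.2⟩) g.2)
      (Submodule.mem_map_of_mem (f := Γ) (r := ⟨f, hTS.1 f.2⟩) f.2)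
      ((mem_krein_iff_boundaryMap hS hker).not.1 hg)
      ((mem_friedrichs_iff_boundaryMap hS hη hker).not.1 hf)
    rintro _ ⟨x, hx, rfl⟩
    exact ⟨_, hKT.map_mem_iff.2 hx, boundaryMap_map hS hη hker hKS hζ₀ hζ x⟩
  obtain ⟨x, hx, hΓx⟩ : (-Complex.I, 1) ∈ (T.domain.comap S†.domain.subtype).map Γ :=
    htop ▸ trivial
  have him := hT.im_boundaryMap_nonneg hST hS hη hker hx
  norm_num [Γ, hΓx] at him

theorem IsMaxDissipative.isKInvariant_of_norm_eq_one (hT : IsMaxDissipative T) (hST : S ≤ T)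
    (hS : IsStrictlyPos S) (hη : ‖η‖ = 1) (hker : kernel S† = Submodule.span ℂ {η})
    (hKS : IsKInvariant (K : H →L[ℂ] H) S) (hζ : (K : H →L[ℂ] H) η = ζ • η) (hζ₁ : ‖ζ‖ = 1) :
    IsKInvariant (K : H →L[ℂ] H) T := by
  have hTS := hT.1.le_adjoint hS.toIsSymm hST
  have hadj := hKS.adjoint hS.dense
  have hζ₀ : ζ ≠ 0 := norm_ne_zero_iff.1 (hζ₁ ▸ one_ne_zero)
  have hdiff : ∀ f : S†.domain, (K : H →L[ℂ] H) f - ζ • (f : H) ∈ T.domain := fun f => by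
    refine hT.mem_of_boundaryMap_eq_zero hST hS hη hker (f := hadj.map f - ζ • f) ?_
    rw [map_sub, map_smul, boundaryMap_map hS hη hker hKS hζ₀ hζ,
      (inv_conj_eq_self_iff hζ₀).2 hζ₁]
    exact sub_self _
  refine (hadj.iff_of_le hTS).2 fun f => ⟨fun hf => ?_, fun hf => ?_⟩
  · have h := sub_mem hf (hdiff ⟨f, hadj.map_mem_iff.1 (hTS.1 hf)⟩)
    rw [sub_sub_cancel] at h
    exact (T.domain.smul_mem_iff hζ₀).1 h
  · exact (T.domain.sub_mem_iff_left (T.domain.smul_mem ζ hf)).1 (hdiff ⟨f, hTS.1 hf⟩)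

theorem isKInvariant_maxDissipative_iff (hS : IsStrictlyPos S) (hη : ‖η‖ = 1)
    (hker : kernel S† = Submodule.span ℂ {η}) (hKS : IsKInvariant (K : H →L[ℂ] H) S)
    (hζ₀ : ζ ≠ 0) (hζ : (K : H →L[ℂ] H) η = ζ • η) (hζ₁ : ‖ζ‖ ≠ 1) :
    S ≤ T ∧ IsMaxDissipative T ∧ IsKInvariant (K : H →L[ℂ] H) T ↔
      T = friedrichs S hS.isNonneg ∨ T = krein S hS.isNonneg := by
  have hF := isMaxDissipative_of_isSelfAdjoint hS.isSelfAdjoint_friedrichs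
  have hK := isMaxDissipative_of_isSelfAdjoint hS.isSelfAdjoint_krein
  constructor
  · rintro ⟨hST, hT, hKT⟩
    exact (hT.1.le_friedrichs_or_le_krein hST hKT hS hη hker hKS hζ₀ hζ hζ₁).imp
      (fun h => (hT.2 _ hF.1 h).symm) fun h => (hT.2 _ hK.1 h).symm
  · rintro (rfl | rfl)
    · exact ⟨le_friedrichs hS.isNonneg, hF, hKS.friedrichs hS.isNonneg⟩
    · exact ⟨le_krein hS.isNonneg, hK, hKS.krein hS⟩

end Invariance

end BoundaryValues

end

end KInv

theorem theoremt2p17_general {H : Type*} [NormedAddCommGroup H] [InnerProductSpace ℂ H]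
    [CompleteSpace H] (S : H →ₗ.[ℂ] H) (hS : KInv.IsStrictlyPos S)
    (K : H →L[ℂ] H) (hK : IsUnit K) (hKS : KInv.IsKInvariant K S)
    (η : H) (hη : ‖η‖ = 1) (hker : KInv.kernel S† = Submodule.span ℂ {η}) :
    KInv.IsLargestExt S (KInv.friedrichs S hS.isNonneg) ∧
    KInv.IsSmallestExt S (KInv.krein S hS.isNonneg) ∧
    ∃ ζ : ℂ, K η = ζ • η ∧
      (‖ζ‖ ≠ 1 →
        KInv.friedrichs S hS.isNonneg ≠ KInv.krein S hS.isNonneg ∧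
        ∀ T : H →ₗ.[ℂ] H,
          (S ≤ T ∧ KInv.IsMaxDissipative T ∧ KInv.IsKInvariant K T) ↔
            (T = KInv.friedrichs S hS.isNonneg ∨ T = KInv.krein S hS.isNonneg)) ∧
      (‖ζ‖ = 1 →
        ∀ T : H →ₗ.[ℂ] H, S ≤ T → KInv.IsMaxDissipative T → KInv.IsKInvariant K T) := by
  obtain ⟨K, rfl⟩ := hK
  have hη₀ : η ≠ 0 := norm_ne_zero_iff.1 (hη ▸ one_ne_zero)
  obtain ⟨ζ, hζ₀, hζ⟩ := hKS.exists_ne_zero_apply_eq_smul hS.dense hη₀ hker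
  refine ⟨hS.isLargestExt_friedrichs, hS.isSmallestExt_krein, ζ, hζ, fun hζ₁ => ?_,
    fun hζ₁ T hST hT => hT.isKInvariant_of_norm_eq_one hST hS hη hker hKS hζ hζ₁⟩
  exact ⟨hS.friedrichs_ne_krein (by simpa [hker] using hη₀), fun T =>
    KInv.isKInvariant_maxDissipative_iff hS hη hker hKS hζ₀ hζ hζ₁⟩

theorem theoremt2p17 {H : Type*} [NormedAddCommGroup H] [InnerProductSpace ℂ H] [CompleteSpace H]
    (S : H →ₗ.[ℂ] H) (hS : KInv.IsStrictlyPos S) (hclosed : S.IsClosed)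
    (K : H →L[ℂ] H) (hK : IsUnit K) (hKS : KInv.IsKInvariant K S)
    (η : H) (hη : ‖η‖ = 1) (hker : KInv.kernel S† = Submodule.span ℂ {η}) :
    KInv.IsLargestExt S (KInv.friedrichs S hS.isNonneg) ∧
    KInv.IsSmallestExt S (KInv.krein S hS.isNonneg) ∧
    ∃ ζ : ℂ, K η = ζ • η ∧
      (‖ζ‖ ≠ 1 →
        KInv.friedrichs S hS.isNonneg ≠ KInv.krein S hS.isNonneg ∧
        ∀ T : H →ₗ.[ℂ] H,
          (S ≤ T ∧ KInv.IsMaxDissipative T ∧ KInv.IsKInvariant K T) ↔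
            (T = KInv.friedrichs S hS.isNonneg ∨ T = KInv.krein S hS.isNonneg)) ∧
      (‖ζ‖ = 1 →
        ∀ T : H →ₗ.[ℂ] H, S ≤ T → KInv.IsMaxDissipative T → KInv.IsKInvariant K T) :=
  theoremt2p17_general S hS K hK hKS η hη hker
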